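/- Let $n\ge 1$, $0<\alpha<n$, $1\le s<\frac n\alpha$ and $0<p<\infty$. Cubes have sides parallel to the axes, and $\ell(Q)$ is the side length of $Q$. A dyadic grid is a collection $\mathscr D$ of cubes in $\mathbb R^n$ with side lengths of the form $2^k$, $k\in\mathbb Z$, such that for each $k$ the cubes of side length $2^k$ in $\mathscr D$ partition $\mathbb R^n$, and $Q\cap P\in\{\varnothing,P,Q\}$ for all $Q,P\in\mathscr D$. A family $\mathscr S$ of cubes is sparse if it is contained in some dyadic grid and there are pairwise disjoint measurable sets $E_Q\subseteq Q$, $Q\in\mathscr S$, with $|Q|\le 2|E_Q|$. For measurable $f$ put $$I^{\mathscr S}_{\alpha,L^s}f(x)=\sum_{Q\in\mathscr S}\ell(Q)^\alpha\Big(\frac1{|Q|}\int_Q|f|^s\Big)^{1/s}\mathbf 1_Q(x),\qquad M_{\alpha,L^s}f(x)=\sup_{Q\ni x}\ell(Q)^\alpha\Big(\frac1{|Q|}\int_Q|f|^s\Big)^{1/s},$$ the supremum being over all cubes $Q$ containing $x$, and for $0<\beta<n$ and $g\ge0$ let $$I_\beta g(x)=c_{n,\beta}\int_{\mathbb R^n}\frac{g(y)}{|x-y|^{n-\beta}}\,dy,\qquad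 c_{n,\beta}=\frac{\Gamma(\frac{n-\beta}2)}{\pi^{n/2}2^\beta\Gamma(\frac\beta2)},$$ be the Riesz potential. Let $w\in A_\infty=\bigcup_{1<q<\infty}A_q$, where $A_q$ is the Muckenhoupt class of locally integrable, a.e. positive $w$ with $$\sup_Q\Big(\frac1{|Q|}\int_Qw\Big)\Big(\frac1{|Q|}\int_Qw^{-\frac1{q-1}}\Big)^{q-1}<\infty ,$$ and write $\|g\|_{L^p(w)}=\big(\int|g|^pw\big)^{1/p}$, $\|g\|_{L^{p,\infty}(w)}=\sup_{t>0}t\,w(\{|g|>t\})^{1/p}$, where $w(E)=\int_E w$. Then there is a constant $C>0$, depending only on $n,\alpha,s,p,w$, such that for every sparse family $\mathscr S$ and every measurable function $f$ on $\mathbb R^n$ (all quantities being allowed to be $+\infty$) $$\|I^{\mathscr S}_{\alpha,L^s}f\|_{L^p(w)}\le C\|M_{\alpha,L^s}f\|_{L^p(w)},\qquad \|I^{\mathscr S}_{\alpha,L^s}f\|_{L^{p,\infty}(w)}\le C\|M_{\alpha,L^s}f\|_{L^{p,\infty}(w)},$$ and consequently also $$\|I^{\mathscr S}_{\alpha,L^s}f\|_{L^p(w)}\le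 C\big\|[I_{\alpha s}(|f|^s)]^{1/s}\big\|_{L^p(w)},\qquad \|I^{\mathscr S}_{\alpha,L^s}f\|_{L^{p,\infty}(w)}\le C\big\|[I_{\alpha s}(|f|^s)]^{1/s}\big\|_{L^{p,\infty}(w)}.$$ -/

import Mathlib

open MeasureTheory
open scoped ENNReal NNReal

/-- A (half-open, axis-parallel) cube in `ℝⁿ`, given by its lower corner and its side length. -/
structure AxisCube (n : ℕ) where
  corner : EuclideanSpace ℝ (Fin n)
  side : ℝ
  side_pos : 0 < side

/-- The set of points of the cube: `corner + [0, side)ⁿ`. -/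
def AxisCube.toSet {n : ℕ} (Q : AxisCube n) : Set (EuclideanSpace ℝ (Fin n)) :=
  {x | ∀ i, x i ∈ Set.Ico (Q.corner i) (Q.corner i + Q.side)}

/-- Dyadic grids: all side lengths are powers of two, for each `k` the cubes of side `2 ^ k`
partition `ℝⁿ`, and any two cubes are nested or disjoint. -/
structure IsDyadicGrid {n : ℕ} (D : Set (AxisCube n)) : Prop where
  side_eq : ∀ Q ∈ D, ∃ k : ℤ, Q.side = (2 : ℝ) ^ k
  partition : ∀ (k : ℤ) (x : EuclideanSpace ℝ (Fin n)),
    ∃! Q : AxisCube n, Q ∈ D ∧ Q.side = (2 : ℝ) ^ k ∧ x ∈ Q.toSet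
  nested : ∀ Q ∈ D, ∀ P ∈ D, Q.toSet ∩ P.toSet = ∅ ∨ Q.toSet ∩ P.toSet = P.toSet ∨
    Q.toSet ∩ P.toSet = Q.toSet

/-- A sparse family: a subfamily of some dyadic grid for which there are pairwise disjoint
measurable sets `E Q ⊆ Q` with `|Q| ≤ 2 |E Q|`. -/
def IsSparseFamily {n : ℕ} (S : Set (AxisCube n)) : Prop :=
  ∃ D : Set (AxisCube n), IsDyadicGrid D ∧ S ⊆ D ∧
    ∃ E : AxisCube n → Set (EuclideanSpace ℝ (Fin n)),
      (∀ Q ∈ S, MeasurableSet (E Q) ∧ E Q ⊆ Q.toSet ∧ volume Q.toSet ≤ 2 * volume (E Q)) ∧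
      S.PairwiseDisjoint E

/-- The Muckenhoupt class `A_q`, `1 < q < ∞`: locally integrable weights `w`, positive almost
everywhere, with `sup_Q (⨍_Q w) (⨍_Q w ^ (-1 / (q - 1))) ^ (q - 1) < ∞`. -/
structure IsMuckenhouptWeight {n : ℕ} (q : ℝ) (w : EuclideanSpace ℝ (Fin n) → ℝ) : Prop where
  locallyIntegrable : LocallyIntegrable w volume
  pos : ∀ᵐ x, 0 < w x
  bound : ∃ K : ℝ≥0, ∀ Q : AxisCube n,
    (⨍⁻ x in Q.toSet, ENNReal.ofReal (w x) ∂volume) *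
      (⨍⁻ x in Q.toSet, ENNReal.ofReal (w x) ^ (-1 / (q - 1)) ∂volume) ^ (q - 1) ≤ K

/-- The class `A_∞`, the union of the classes `A_q`, `1 < q < ∞`. -/
def IsAInftyWeight {n : ℕ} (w : EuclideanSpace ℝ (Fin n) → ℝ) : Prop :=
  ∃ q : ℝ, 1 < q ∧ IsMuckenhouptWeight q w

/-- The measure `w dx`. -/
noncomputable def weightMeasure {n : ℕ} (w : EuclideanSpace ℝ (Fin n) → ℝ) :
    Measure (EuclideanSpace ℝ (Fin n)) :=
  volume.withDensity fun x => ENNReal.ofReal (w x)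

/-- The term `ℓ(Q) ^ α (⨍_Q |f| ^ s) ^ (1 / s)`. -/
noncomputable def fracAverage {n : ℕ} {𝕜 : Type*} [RCLike 𝕜] (α s : ℝ)
    (f : EuclideanSpace ℝ (Fin n) → 𝕜) (Q : AxisCube n) : ℝ≥0∞ :=
  ENNReal.ofReal (Q.side ^ α) * (⨍⁻ y in Q.toSet, ‖f y‖ₑ ^ s ∂volume) ^ (1 / s)

/-- The `L^s` sparse fractional operator
`∑_{Q ∈ S} ℓ(Q) ^ α (⨍_Q |f| ^ s) ^ (1 / s) 1_Q(x)`. -/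
noncomputable def sparseFracOp {n : ℕ} {𝕜 : Type*} [RCLike 𝕜] (α s : ℝ) (S : Set (AxisCube n))
    (f : EuclideanSpace ℝ (Fin n) → 𝕜) (x : EuclideanSpace ℝ (Fin n)) : ℝ≥0∞ :=
  ∑' Q : S, (Q : AxisCube n).toSet.indicator (fun _ => fracAverage α s f Q) x

/-- The `L^s` fractional maximal function
`sup_{Q ∋ x} ℓ(Q) ^ α (⨍_Q |f| ^ s) ^ (1 / s)`. -/
noncomputable def fracMaximal {n : ℕ} {𝕜 : Type*} [RCLike 𝕜] (α s : ℝ)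
    (f : EuclideanSpace ℝ (Fin n) → 𝕜) (x : EuclideanSpace ℝ (Fin n)) : ℝ≥0∞ :=
  ⨆ (Q : AxisCube n) (_ : x ∈ Q.toSet), fracAverage α s f Q

/-- The normalizing constant of the Riesz potential of order `β` on `ℝⁿ`. -/
noncomputable def rieszConst (n : ℕ) (β : ℝ) : ℝ :=
  Real.Gamma ((n - β) / 2) / (Real.pi ^ ((n : ℝ) / 2) * 2 ^ β * Real.Gamma (β / 2))

/-- The Riesz potential of order `β` of a nonnegative function,
`c_{n,β} ∫ g(y) / |x - y| ^ (n - β) dy`. -/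
noncomputable def rieszPotential {n : ℕ} (β : ℝ) (g : EuclideanSpace ℝ (Fin n) → ℝ≥0∞)
    (x : EuclideanSpace ℝ (Fin n)) : ℝ≥0∞ :=
  ENNReal.ofReal (rieszConst n β) * ∫⁻ y, g y / ‖x - y‖ₑ ^ ((n : ℝ) - β)

/-- The weak `L^{p,∞}(μ)` quasinorm `sup_{t > 0} t μ({g > t}) ^ (1 / p)`. -/
noncomputable def weakLpNorm {X : Type*} [MeasurableSpace X] (g : X → ℝ≥0∞) (p : ℝ)
    (μ : Measure X) : ℝ≥0∞ :=
  ⨆ t : ℝ≥0, (t : ℝ≥0∞) * μ {x | (t : ℝ≥0∞) < g x} ^ (1 / p)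

/-! The engine is a good-λ inequality for the measure `μ = w dx`. The `A_q` condition and Hölder's
inequality show that a subset carrying half the volume of a cube carries at least a fixed fraction
`1/Λ` of its `w`-mass. So a sparse family stays sparse for `μ`, and only nestedness and `μ(A) ≤ Λ
μ(E)` are used afterwards.

For a finite subfamily let `T` be the sum and `M` the maximum of the terms. If `T(x) > 2t` and `M(x)
≤ γt`, then the large cubes through `x`, taken until the accumulated sum exceeds `t`, leave more
than `t` to be supplied by small cubes worth at most `γt` each. So at least `1/γ` small cubes
contain `x`. These cubes lie in `{T > t}`, and sparseness bounds their total mass by `Λ μ{T > t}`.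
Chebyshev then gives `μ{T > 2t} ≤ γΛ μ{T > t} + μ{M > γt}` (`measure_two_mul_lt_familySum_le`).

Integrating against `t^(p-1)`, or taking a supremum over `t`, and choosing `γ` with `2^p γΛ ≤ 1/2`,
the `T` term is absorbed; it is finite because the subfamily is. The bounds do not depend on the
subfamily, so they pass to the whole sum. No triangle inequality is used, hence every `p > 0` is
allowed.

The Riesz potential bounds follow because its kernel on a cube `Q` is at least a constant times
`ℓ(Q)^(αs-n)`, so it dominates the maximal function pointwise. -/

section NestedFamilies

/-! ### Stopping families and the good-λ inequality. -/

variable {X ι : Type*}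

/-- For a nested family of sets `A i` with coefficients `a i`, the members of `F` at which the
accumulated coefficient of the larger sets exceeds `t`. -/
noncomputable def stoppingFamily (A : ι → Set X) (a : ι → ℝ≥0) (F : Finset ι) (t : ℝ≥0) :
    Finset ι := by
  classical exact F.filter fun i => t < ∑ j ∈ F.filter fun j => A i ⊆ A j, a j

/-- The sum `∑ i ∈ F, a i 1_{A i}`. -/
noncomputable def familySum (A : ι → Set X) (a : ι → ℝ≥0) (F : Finset ι) (x : X) : ℝ≥0 :=
  ∑ i ∈ F, (A i).indicator (fun _ => a i) x

/-- The maximal function `max_{i ∈ F} a i 1_{A i}`. -/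
noncomputable def familyMax (A : ι → Set X) (a : ι → ℝ≥0) (F : Finset ι) (x : X) : ℝ≥0 :=
  F.sup fun i => (A i).indicator (fun _ => a i) x

variable {A : ι → Set X} {a : ι → ℝ≥0} {F : Finset ι} {t : ℝ≥0}

theorem mem_stoppingFamily {i : ι} [DecidablePred fun j => A i ⊆ A j] :
    i ∈ stoppingFamily A a F t ↔ i ∈ F ∧ t < ∑ j ∈ F.filter fun j => A i ⊆ A j, a j := by
  classical
  unfold stoppingFamily
  rw [Finset.mem_filter]
  refine and_congr_right fun _ => ?_
  simp only [Finset.sum_filter]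
  exact iff_of_eq (by congr!)

theorem lt_familySum_of_mem_stoppingFamily {i : ι} {x : X}
    (hi : i ∈ stoppingFamily A a F t) (hx : x ∈ A i) : t < familySum A a F x := by
  classical
  refine (mem_stoppingFamily.1 hi).2.trans_le ?_
  unfold familySum
  rw [Finset.sum_filter]
  refine Finset.sum_le_sum fun j _ => ?_
  split_ifs with h
  · rw [Set.indicator_of_mem (h hx)]
  · exact zero_le

theorem familySum_eq_sum_filter (x : X) [DecidablePred fun i => x ∈ A i] :
    familySum A a F x = ∑ i ∈ F with x ∈ A i, a i := by
  unfold familySum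
  rw [Finset.sum_filter]
  refine Finset.sum_congr rfl fun i _ => ?_
  by_cases h : x ∈ A i <;> simp [h]

/-- The sets through `x` form a chain, so all non-stopping ones contain a minimal one among them.
Their sum is part of its accumulated coefficient, which is at most `t`. -/
theorem sum_not_mem_stoppingFamily_le [DecidableEq ι]
    (hA : ∀ i j, A i ⊆ A j ∨ A j ⊆ A i ∨ Disjoint (A i) (A j)) (x : X)
    [DecidablePred fun i => x ∈ A i] :
    ∑ i ∈ F with x ∈ A i ∧ i ∉ stoppingFamily A a F t, a i ≤ t := by
  classical
  set H := F.filter fun i => x ∈ A i ∧ i ∉ stoppingFamily A a F t with hH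
  rcases H.eq_empty_or_nonempty with h | h
  · simp [h]
  obtain ⟨i, hi⟩ := H.exists_minimalFor A h
  have hiH : i ∈ F ∧ x ∈ A i ∧ i ∉ stoppingFamily A a F t := by
    simpa [hH] using hi.prop
  have hsum : ∑ j ∈ F.filter (fun j => A i ⊆ A j), a j ≤ t := by
    by_contra hlt
    exact hiH.2.2 (mem_stoppingFamily.2 ⟨hiH.1, not_le.1 hlt⟩)
  refine le_trans (Finset.sum_le_sum_of_subset ?_) hsum
  intro j hj
  have hjH : j ∈ F ∧ x ∈ A j ∧ j ∉ stoppingFamily A a F t := by simpa [hH] using hj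
  refine Finset.mem_filter.2 ⟨hjH.1, ?_⟩
  rcases hA i j with h1 | h1 | h1
  · exact h1
  · exact hi.le_of_le hj h1
  · exact absurd hjH.2.1 (Set.disjoint_left.1 h1 hiH.2.1)

/-- The non-stopping members contribute at most `t`, so the stopping ones contribute more than `t`
in terms of size at most `γt`; hence at least `1/γ` of them contain `x`. -/
theorem one_le_mul_sum_indicator_stoppingFamily
    (hA : ∀ i j, A i ⊆ A j ∨ A j ⊆ A i ∨ Disjoint (A i) (A j)) {γ : ℝ≥0} {x : X}
    (hT : 2 * t < familySum A a F x) (hM : familyMax A a F x ≤ γ * t) :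
    1 ≤ γ * ∑ i ∈ stoppingFamily A a F t, (A i).indicator (fun _ => (1 : ℝ≥0)) x := by
  classical
  have hsplit : familySum A a F x =
      ∑ i ∈ F with x ∈ A i ∧ i ∉ stoppingFamily A a F t, a i +
      ∑ i ∈ F with x ∈ A i ∧ i ∈ stoppingFamily A a F t, a i := by
    rw [familySum_eq_sum_filter, ← Finset.sum_filter_add_sum_filter_not _
      (fun i => i ∉ stoppingFamily A a F t), Finset.filter_filter, Finset.filter_filter]
    simp
  have h1 := sum_not_mem_stoppingFamily_le (a := a) (F := F) (t := t) hA x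
  have h2 : ∑ i ∈ F with x ∈ A i ∧ i ∈ stoppingFamily A a F t, a i ≤
      γ * t * ∑ i ∈ stoppingFamily A a F t, (A i).indicator (fun _ => (1 : ℝ≥0)) x := by
    rw [Finset.mul_sum, Finset.sum_filter]
    have hsub : stoppingFamily A a F t ⊆ F := fun i hi => (mem_stoppingFamily.1 hi).1
    rw [← Finset.sum_subset hsub (fun i _ hi => by simp [hi])]
    refine Finset.sum_le_sum fun i hi => ?_
    by_cases hx : x ∈ A i
    · have : a i ≤ familyMax A a F x := by
        have := Finset.le_sup (f := fun i => (A i).indicator (fun _ => a i) x) (hsub hi)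
        rwa [Set.indicator_of_mem hx] at this
      simpa [hx, hi] using this.trans hM
    · simp [hx]
  -- Strictness lets `t` be cancelled without a separate case `t = 0`.
  have h3 : t * 1 < t * (γ * ∑ i ∈ stoppingFamily A a F t,
      (A i).indicator (fun _ => (1 : ℝ≥0)) x) := by
    have : t + t < t + γ * t * ∑ i ∈ stoppingFamily A a F t,
        (A i).indicator (fun _ => (1 : ℝ≥0)) x := by
      rw [← two_mul]
      exact hT.trans_le (hsplit ▸ add_le_add h1 h2)
    rw [mul_one, ← mul_assoc, mul_comm t γ]
    exact lt_of_add_lt_add_left this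
  exact (lt_of_mul_lt_mul_left' h3).le

theorem coe_familySum (a : ι → ℝ≥0) (F : Finset ι) (x : X) :
    (familySum A a F x : ℝ≥0∞) = ∑ i ∈ F, (A i).indicator (fun _ => (a i : ℝ≥0∞)) x := by
  unfold familySum
  push_cast
  rfl

theorem coe_familyMax_le {a : ι → ℝ≥0} {M : X → ℝ≥0∞} (hM : ∀ i, ∀ x ∈ A i, a i ≤ M x)
    (F : Finset ι) (x : X) : (familyMax A a F x : ℝ≥0∞) ≤ M x := by
  unfold familyMax
  induction F using Finset.cons_induction with
  | empty => simp
  | cons i F hi ih =>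
    rw [Finset.sup_cons, ENNReal.coe_max]
    refine max_le ?_ ih
    by_cases hx : x ∈ A i
    · simpa [hx] using hM i x hx
    · simp [hx]

theorem tsum_indicator_eq_iSup_familySum (a : ι → ℝ≥0) (x : X) :
    ∑' i, (A i).indicator (fun _ => (a i : ℝ≥0∞)) x = ⨆ F, (familySum A a F x : ℝ≥0∞) := by
  rw [ENNReal.tsum_eq_iSup_sum]
  exact iSup_congr fun F => (coe_familySum a F x).symm

theorem monotone_familySum (a : ι → ℝ≥0) (x : X) :
    Monotone fun F => familySum A a F x := fun _ _ h => Finset.sum_le_sum_of_subset h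

variable [MeasurableSpace X] {μ : Measure X} {E : ι → Set X} {Λ : ℝ≥0}

theorem measurable_familySum (hm : ∀ i, MeasurableSet (A i)) : Measurable (familySum A a F) :=
  Finset.measurable_fun_sum _ fun i _ => measurable_const.indicator (hm i)

theorem measurable_familyMax (hm : ∀ i, MeasurableSet (A i)) : Measurable (familyMax A a F) := by
  have : familyMax A a F = F.sup fun i => (A i).indicator (fun _ => a i) := by
    ext x; simp [familyMax, Finset.sup_apply]
  rw [this]
  refine Finset.sup_induction measurable_const (fun f hf g hg => hf.sup hg) fun i _ =>
    measurable_const.indicator (hm i)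

/-- Carleson packing: the disjoint sets `E i` all fit into `B`. -/
theorem sum_measure_le_of_sparse {G : Finset ι} {B : Set X}
    (hmE : ∀ i, MeasurableSet (E i)) (hEA : ∀ i, E i ⊆ A i)
    (hd : Pairwise fun i j => Disjoint (E i) (E j)) (hE : ∀ i, μ (A i) ≤ Λ * μ (E i))
    (hB : ∀ i ∈ G, A i ⊆ B) : ∑ i ∈ G, μ (A i) ≤ Λ * μ B := by
  calc ∑ i ∈ G, μ (A i) ≤ ∑ i ∈ G, Λ * μ (E i) := Finset.sum_le_sum fun i _ => hE i
    _ = Λ * μ (⋃ i ∈ G, E i) := by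
      rw [← Finset.mul_sum, measure_biUnion_finset (fun i _ j _ h => hd h) fun i _ => hmE i]
    _ ≤ Λ * μ B := by
      gcongr
      exact Set.iUnion₂_subset fun i hi => (hEA i).trans (hB i hi)

/-- The good-`λ` inequality for a sparse nested family. -/
theorem measure_two_mul_lt_familySum_le
    (hA : ∀ i j, A i ⊆ A j ∨ A j ⊆ A i ∨ Disjoint (A i) (A j))
    (hm : ∀ i, MeasurableSet (A i)) (hmE : ∀ i, MeasurableSet (E i)) (hEA : ∀ i, E i ⊆ A i)
    (hd : Pairwise fun i j => Disjoint (E i) (E j)) (hE : ∀ i, μ (A i) ≤ Λ * μ (E i))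
    (γ t : ℝ≥0) :
    μ {x | 2 * t < familySum A a F x} ≤
      γ * Λ * μ {x | t < familySum A a F x} + μ {x | γ * t < familyMax A a F x} := by
  -- `γ` times the number of stopping sets through `x`; Chebyshev at level `1` is applied to it.
  set N : X → ℝ≥0∞ := fun x =>
    γ * ∑ i ∈ stoppingFamily A a F t, (A i).indicator (fun _ => (1 : ℝ≥0∞)) x with hN
  have hmN : Measurable N := by
    refine Measurable.const_mul ?_ _
    exact Finset.measurable_fun_sum _ fun i _ => measurable_const.indicator (hm i)
  have hsub : {x | 2 * t < familySum A a F x} ⊆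
      {x | 1 ≤ N x} ∪ {x | γ * t < familyMax A a F x} := by
    intro x hx
    by_cases hM : γ * t < familyMax A a F x
    · exact Or.inr hM
    · refine Or.inl ?_
      have := one_le_mul_sum_indicator_stoppingFamily hA hx (not_lt.1 hM)
      have h' := ENNReal.coe_le_coe.2 this
      simp only [Set.mem_ofPred_eq, hN]
      push_cast at h'
      refine h'.trans (le_of_eq ?_)
      congr 1
  refine (measure_mono hsub).trans ((measure_union_le _ _).trans ?_)
  gcongr
  calc μ {x | 1 ≤ N x} ≤ ∫⁻ x, N x ∂μ := by
        simpa using mul_meas_ge_le_lintegral (μ := μ) hmN 1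
    _ = γ * ∑ i ∈ stoppingFamily A a F t, μ (A i) := by
        rw [hN, lintegral_const_mul' _ _ ENNReal.coe_ne_top,
          lintegral_finsetSum _ fun i _ => measurable_const.indicator (hm i)]
        congr 1
        refine Finset.sum_congr rfl fun i _ => ?_
        rw [lintegral_indicator (hm i)]
        simp
    _ ≤ γ * (Λ * μ {x | t < familySum A a F x}) := by
        gcongr
        exact sum_measure_le_of_sparse hmE hEA hd hE fun i hi x hx =>
          lt_familySum_of_mem_stoppingFamily hi hx
    _ = _ := by rw [mul_assoc]

end NestedFamilies

/-! ### Layer-cake integration, weak quasinorms and absorption. -/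

section NormBounds

variable {X : Type*} [MeasurableSpace X] {μ : Measure X} {p : ℝ}

theorem weakLpNorm_rpow (hp : 0 < p) (g : X → ℝ≥0∞) :
    weakLpNorm g p μ ^ p = ⨆ t : ℝ≥0, (t : ℝ≥0∞) ^ p * μ {x | (t : ℝ≥0∞) < g x} := by
  have h := (ENNReal.orderIsoRpow p hp).map_iSup
    fun t : ℝ≥0 => (t : ℝ≥0∞) * μ {x | (t : ℝ≥0∞) < g x} ^ (1 / p)
  simp only [ENNReal.orderIsoRpow_apply] at h
  rw [weakLpNorm, h]
  refine iSup_congr fun t => ?_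
  rw [ENNReal.mul_rpow_of_nonneg _ _ hp.le, ← ENNReal.rpow_mul, one_div_mul_cancel hp.ne',
    ENNReal.rpow_one]

theorem weakLpNorm_le_mul (hp : 0 < p) {g h : X → ℝ≥0∞} {c : ℝ≥0} (hc : 0 < c)
    (hgh : ∀ x, g x ≤ c * h x) : weakLpNorm g p μ ≤ c * weakLpNorm h p μ := by
  refine iSup_le fun t => ?_
  have hsub : {x | (t : ℝ≥0∞) < g x} ⊆ {x | ((t / c : ℝ≥0) : ℝ≥0∞) < h x} := by
    intro x hx
    have h1 : (t : ℝ≥0∞) < c * h x := lt_of_lt_of_le hx (hgh x)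
    have h2 : (t : ℝ≥0∞) = c * (t / c : ℝ≥0) := by
      rw [← ENNReal.coe_mul, mul_div_cancel₀ _ hc.ne']
    rw [h2] at h1
    exact lt_of_mul_lt_mul_left' h1
  calc (t : ℝ≥0∞) * μ {x | (t : ℝ≥0∞) < g x} ^ (1 / p)
      ≤ (c * (t / c : ℝ≥0)) * μ {x | ((t / c : ℝ≥0) : ℝ≥0∞) < h x} ^ (1 / p) := by
        rw [← ENNReal.coe_mul, mul_div_cancel₀ _ hc.ne']
        gcongr
    _ ≤ c * weakLpNorm h p μ := by
        rw [mul_assoc]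
        gcongr
        exact le_iSup (fun t : ℝ≥0 => (t : ℝ≥0∞) * μ {x | (t : ℝ≥0∞) < h x} ^ (1 / p)) (t / c)

theorem eLpNorm_ofReal_eq (hp : 0 < p) (g : X → ℝ≥0∞) :
    eLpNorm g (ENNReal.ofReal p) μ = (∫⁻ x, g x ^ p ∂μ) ^ (1 / p) := by
  rw [eLpNorm_eq_lintegral_rpow_enorm_toReal (by simpa using hp) ENNReal.ofReal_ne_top,
    ENNReal.toReal_ofReal hp.le]
  simp

/-- Distribution function bounds are integrated against `p t^(p-1) dt`, which is linear in them for
every `p > 0`. -/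
theorem lintegral_rpow_le_of_measure_lt_le (hp : 0 < p) {f g h : X → ℝ≥0} (hf : Measurable f)
    (hg : Measurable g) (hh : Measurable h) {c : ℝ≥0}
    (H : ∀ t : ℝ≥0, μ {x | t < f x} ≤ c * μ {x | t < g x} + μ {x | t < h x}) :
    ∫⁻ x, (f x : ℝ≥0∞) ^ p ∂μ ≤
      c * ∫⁻ x, (g x : ℝ≥0∞) ^ p ∂μ + ∫⁻ x, (h x : ℝ≥0∞) ^ p ∂μ := by
  have key : ∀ k : X → ℝ≥0, Measurable k → ∫⁻ x, (k x : ℝ≥0∞) ^ p ∂μ =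
      ENNReal.ofReal p * ∫⁻ t in Set.Ioi (0 : ℝ),
        μ {x | t < (k x : ℝ)} * ENNReal.ofReal (t ^ (p - 1)) := by
    intro k hk
    rw [← lintegral_rpow_eq_lintegral_meas_lt_mul μ (f := fun x => (k x : ℝ))
      (Filter.Eventually.of_forall fun x => (k x).2) hk.coe_nnreal_real.aemeasurable hp]
    refine lintegral_congr fun x => ?_
    rw [← ENNReal.ofReal_rpow_of_nonneg (k x).coe_nonneg hp.le, ENNReal.ofReal_coe_nnreal]
  have hmeas : ∀ k : X → ℝ≥0, Measurable fun t : ℝ =>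
      μ {x | t < (k x : ℝ)} * ENNReal.ofReal (t ^ (p - 1)) := by
    intro k
    refine Measurable.mul (Antitone.measurable fun s t hst => measure_mono fun x hx => ?_)
      (by fun_prop)
    exact lt_of_le_of_lt hst hx
  rw [key f hf, key g hg, key h hh, ← mul_assoc, mul_comm (c : ℝ≥0∞), mul_assoc, ← mul_add,
    ← lintegral_const_mul _ (hmeas g), ← lintegral_add_right _ (hmeas h)]
  refine mul_le_mul_right (setLIntegral_mono' measurableSet_Ioi fun t ht => ?_) _
  lift t to ℝ≥0 using le_of_lt ht
  rw [← mul_assoc, ← add_mul]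
  gcongr
  simpa using H t

/-- The absorption step. It fails for `a = ∞`, which is why finite subfamilies are treated first. -/
theorem ENNReal.le_two_mul_of_le_half_add {a b c : ℝ≥0∞} (ha : a ≠ ∞) (hc : c ≤ 2⁻¹)
    (h : a ≤ c * a + b) : a ≤ 2 * b := by
  have h1 : a ≤ a / 2 + b := h.trans (by
    rw [ENNReal.div_eq_inv_mul]
    gcongr)
  have h2 : a / 2 ≤ b := by
    have : a / 2 + a / 2 ≤ a / 2 + b := by rwa [ENNReal.add_halves]
    exact (ENNReal.add_le_add_iff_left (ENNReal.div_ne_top ha two_ne_zero)).1 this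
  calc a = 2 * (a / 2) := by rw [ENNReal.mul_div_cancel two_ne_zero ENNReal.ofNat_ne_top]
    _ ≤ 2 * b := by gcongr

end NormBounds

/-! ### Strong and weak bounds for sparse sums over an abstract measure. -/

section SparseFamilies

variable {X ι : Type*} [MeasurableSpace X] {μ : Measure X} {p : ℝ} {A E : ι → Set X} {Λ γ : ℝ≥0}

theorem lintegral_familySum_rpow_le (hp : 0 < p)
    (hA : ∀ i j, A i ⊆ A j ∨ A j ⊆ A i ∨ Disjoint (A i) (A j))
    (hm : ∀ i, MeasurableSet (A i)) (hmE : ∀ i, MeasurableSet (E i)) (hEA : ∀ i, E i ⊆ A i)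
    (hd : Pairwise fun i j => Disjoint (E i) (E j)) (hE : ∀ i, μ (A i) ≤ Λ * μ (E i))
    (hfin : ∀ i, μ (A i) ≠ ∞) (hγ : 0 < γ) (hγΛ : (2 : ℝ≥0) ^ p * (γ * Λ) ≤ 2⁻¹)
    (a : ι → ℝ≥0) (F : Finset ι) :
    ∫⁻ x, (familySum A a F x : ℝ≥0∞) ^ p ∂μ ≤
      2 * ((2 / γ : ℝ≥0) ^ p * ∫⁻ x, (familyMax A a F x : ℝ≥0∞) ^ p ∂μ) := by
  have hT : Measurable (familySum A a F) := measurable_familySum hm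
  have hM : Measurable (familyMax A a F) := measurable_familyMax hm
  -- Dividing `T` by `2` and `M` by `γ` puts all three level sets of the good-λ inequality at the
  -- same height `t`.
  have hlayer := lintegral_rpow_le_of_measure_lt_le (μ := μ) hp (hT.div_const 2) hT
    (hM.div_const γ) (c := γ * Λ) fun t => by
      have := measure_two_mul_lt_familySum_le (μ := μ) (a := a) (F := F) hA hm hmE hEA hd hE γ t
      simpa only [lt_div_iff₀ hγ, lt_div_iff₀ (two_pos : (0 : ℝ≥0) < 2), mul_comm t,
        ENNReal.coe_mul] using this
  have hscale : ∀ (k : X → ℝ≥0) (r : ℝ≥0), 0 < r → ∫⁻ x, ((k x / r : ℝ≥0) : ℝ≥0∞) ^ p ∂μ =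
      ((r⁻¹ : ℝ≥0) : ℝ≥0∞) ^ p * ∫⁻ x, (k x : ℝ≥0∞) ^ p ∂μ := by
    intro k r hr
    rw [← lintegral_const_mul' _ _ (ENNReal.rpow_ne_top_of_nonneg hp.le ENNReal.coe_ne_top)]
    refine lintegral_congr fun x => ?_
    rw [div_eq_inv_mul, ENNReal.coe_mul, ENNReal.mul_rpow_of_nonneg _ _ hp.le]
  rw [hscale _ 2 two_pos, hscale _ γ hγ] at hlayer
  refine ENNReal.le_two_mul_of_le_half_add (c := ((2 : ℝ≥0) ^ p * (γ * Λ) : ℝ≥0)) ?_ ?_ ?_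
  -- Finiteness for absorption: the finite sum is bounded and supported on a set of finite measure.
  · have hle : ∀ x, (familySum A a F x : ℝ≥0∞) ^ p ≤
        (⋃ i ∈ F, A i).indicator (fun _ => ((∑ i ∈ F, a i : ℝ≥0) : ℝ≥0∞) ^ p) x := by
      intro x
      by_cases hx : x ∈ ⋃ i ∈ F, A i
      · rw [Set.indicator_of_mem hx]
        gcongr
        exact Finset.sum_le_sum fun i _ => Set.indicator_le_self' (fun _ _ => zero_le) x
      · have : familySum A a F x = 0 := Finset.sum_eq_zero fun i hi =>
          Set.indicator_of_notMem (fun h => hx (Set.mem_biUnion hi h)) _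
        simp [this, hp]
    refine ne_top_of_le_ne_top ?_ (lintegral_mono hle)
    rw [lintegral_indicator (Finset.measurableSet_biUnion F fun i _ => hm i), setLIntegral_const]
    refine ENNReal.mul_ne_top (ENNReal.rpow_ne_top_of_nonneg hp.le ENNReal.coe_ne_top) ?_
    exact ((measure_biUnion_finset_le F A).trans_lt
      (ENNReal.sum_lt_top.2 fun i _ => (hfin i).lt_top)).ne
  · exact (ENNReal.coe_le_coe.2 hγΛ).trans (by simp)
  · calc ∫⁻ x, (familySum A a F x : ℝ≥0∞) ^ p ∂μ
        = 2 ^ p * (((2⁻¹ : ℝ≥0) : ℝ≥0∞) ^ p * ∫⁻ x, (familySum A a F x : ℝ≥0∞) ^ p ∂μ) := by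
          rw [← mul_assoc, ← ENNReal.mul_rpow_of_nonneg _ _ hp.le, ENNReal.coe_inv two_ne_zero,
            ENNReal.coe_ofNat, ENNReal.mul_inv_cancel two_ne_zero ENNReal.ofNat_ne_top,
            ENNReal.one_rpow, one_mul]
      _ ≤ 2 ^ p * (_ + _) := by gcongr
      _ = _ := by
          rw [mul_add, ← mul_assoc, ← mul_assoc, div_eq_mul_inv,
            ENNReal.coe_mul (2 : ℝ≥0), ENNReal.mul_rpow_of_nonneg _ _ hp.le,
            ENNReal.coe_mul (_ ^ p), ENNReal.coe_rpow_of_nonneg _ hp.le, ENNReal.coe_ofNat]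

theorem weakLpNorm_familySum_rpow_le (hp : 0 < p)
    (hA : ∀ i j, A i ⊆ A j ∨ A j ⊆ A i ∨ Disjoint (A i) (A j))
    (hm : ∀ i, MeasurableSet (A i)) (hmE : ∀ i, MeasurableSet (E i)) (hEA : ∀ i, E i ⊆ A i)
    (hd : Pairwise fun i j => Disjoint (E i) (E j)) (hE : ∀ i, μ (A i) ≤ Λ * μ (E i))
    (hfin : ∀ i, μ (A i) ≠ ∞) (hγ : 0 < γ) (hγΛ : (2 : ℝ≥0) ^ p * (γ * Λ) ≤ 2⁻¹)
    (a : ι → ℝ≥0) (F : Finset ι) :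
    weakLpNorm (fun x => (familySum A a F x : ℝ≥0∞)) p μ ^ p ≤
      2 * ((2 / γ : ℝ≥0) ^ p * weakLpNorm (fun x => (familyMax A a F x : ℝ≥0∞)) p μ ^ p) := by
  rw [weakLpNorm_rpow hp, weakLpNorm_rpow hp]
  simp only [ENNReal.coe_lt_coe]
  refine ENNReal.le_two_mul_of_le_half_add (c := ((2 : ℝ≥0) ^ p * (γ * Λ) : ℝ≥0)) ?_ ?_ ?_
  · refine ne_top_of_le_ne_top (b := ((∑ i ∈ F, a i : ℝ≥0) : ℝ≥0∞) ^ p * μ (⋃ i ∈ F, A i)) ?_ ?_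
    · refine ENNReal.mul_ne_top (ENNReal.rpow_ne_top_of_nonneg hp.le ENNReal.coe_ne_top) ?_
      exact ((measure_biUnion_finset_le F A).trans_lt
        (ENNReal.sum_lt_top.2 fun i _ => (hfin i).lt_top)).ne
    · refine iSup_le fun t => ?_
      by_cases ht : t ≤ ∑ i ∈ F, a i
      · gcongr
        intro x hx
        by_contra hx'
        have : familySum A a F x = 0 := Finset.sum_eq_zero fun i hi =>
          Set.indicator_of_notMem (fun h => hx' (Set.mem_biUnion hi h)) _
        simp [this] at hx
      · have : {x | t < familySum A a F x} = ∅ := by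
          refine Set.eq_empty_of_forall_notMem fun x hx => ht (le_of_lt (lt_of_lt_of_le hx ?_))
          exact Finset.sum_le_sum fun i _ => Set.indicator_le_self' (fun _ _ => zero_le) x
        simp [this]
  · exact (ENNReal.coe_le_coe.2 hγΛ).trans (by simp)
  · refine iSup_le fun u => ?_
    -- The weight `(2t)^p` is read as `2^p t^p` for the sum and as `(2/γ)^p (γt)^p` for the maximum.
    obtain ⟨t, rfl⟩ : ∃ t : ℝ≥0, u = 2 * t := ⟨u / 2, by rw [mul_div_cancel₀ _ two_ne_zero]⟩
    have hγt : (((2 * t : ℝ≥0) : ℝ≥0∞)) ^ p =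
        ((2 / γ : ℝ≥0) : ℝ≥0∞) ^ p * ((γ * t : ℝ≥0) : ℝ≥0∞) ^ p := by
      rw [← ENNReal.mul_rpow_of_nonneg _ _ hp.le, ← ENNReal.coe_mul]
      congr 2
      field_simp
    calc ((2 * t : ℝ≥0) : ℝ≥0∞) ^ p * μ {x | 2 * t < familySum A a F x}
        ≤ ((2 * t : ℝ≥0) : ℝ≥0∞) ^ p * (γ * Λ * μ {x | t < familySum A a F x} +
            μ {x | γ * t < familyMax A a F x}) := by
          gcongr
          exact measure_two_mul_lt_familySum_le hA hm hmE hEA hd hE γ t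
      _ = ((2 : ℝ≥0) ^ p * (γ * Λ) : ℝ≥0) * ((t : ℝ≥0∞) ^ p * μ {x | t < familySum A a F x}) +
            ((2 / γ : ℝ≥0) : ℝ≥0∞) ^ p * (((γ * t : ℝ≥0) : ℝ≥0∞) ^ p *
              μ {x | γ * t < familyMax A a F x}) := by
          rw [mul_add, ← mul_assoc (((2 / γ : ℝ≥0) : ℝ≥0∞) ^ p), ← hγt]
          congr 1
          rw [ENNReal.coe_mul, ENNReal.coe_mul, ENNReal.coe_mul,
            ENNReal.mul_rpow_of_nonneg _ _ hp.le, ENNReal.coe_rpow_of_nonneg _ hp.le]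
          ring
      _ ≤ _ := by
          gcongr
          · exact le_iSup (fun t : ℝ≥0 => (t : ℝ≥0∞) ^ p * μ {x | t < familySum A a F x}) t
          · exact le_iSup (fun t : ℝ≥0 => (t : ℝ≥0∞) ^ p * μ {x | t < familyMax A a F x}) (γ * t)

/-- The strong type bound of a sparse sum by its maximal function. -/
theorem lintegral_tsum_indicator_rpow_le [Countable ι] (hp : 0 < p)
    (hA : ∀ i j, A i ⊆ A j ∨ A j ⊆ A i ∨ Disjoint (A i) (A j))
    (hm : ∀ i, MeasurableSet (A i)) (hmE : ∀ i, MeasurableSet (E i)) (hEA : ∀ i, E i ⊆ A i)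
    (hd : Pairwise fun i j => Disjoint (E i) (E j)) (hE : ∀ i, μ (A i) ≤ Λ * μ (E i))
    (hfin : ∀ i, μ (A i) ≠ ∞) (hpos : ∀ i, μ (A i) ≠ 0) (hγ : 0 < γ)
    (hγΛ : (2 : ℝ≥0) ^ p * (γ * Λ) ≤ 2⁻¹) (a : ι → ℝ≥0∞) {M : X → ℝ≥0∞}
    (hM : ∀ i, ∀ x ∈ A i, a i ≤ M x) :
    ∫⁻ x, (∑' i, (A i).indicator (fun _ => a i) x) ^ p ∂μ ≤
      2 * ((2 / γ : ℝ≥0) ^ p * ∫⁻ x, M x ^ p ∂μ) := by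
  -- An infinite coefficient forces `M = ∞` on a set of positive measure, so the right side is
  -- infinite.
  by_cases ha : ∃ i, a i = ∞
  · obtain ⟨i, hi⟩ := ha
    have : ∫⁻ x, M x ^ p ∂μ = ∞ := by
      refine top_le_iff.1 ?_
      calc ∞ = ∫⁻ _ in A i, ∞ ∂μ := by simp [ENNReal.top_mul (hpos i)]
        _ ≤ ∫⁻ x in A i, M x ^ p ∂μ := setLIntegral_mono' (hm i) fun x hx => by
          have := hM i x hx
          rw [hi, top_le_iff] at this
          rw [this, ENNReal.top_rpow_of_pos hp]
        _ ≤ _ := setLIntegral_le_lintegral _ _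
    rw [this, ENNReal.mul_top, ENNReal.mul_top two_ne_zero]
    · exact le_top
    · simp [ENNReal.rpow_eq_zero_iff, hγ.ne', hp.not_gt]
  push Not at ha
  lift a to ι → ℝ≥0 using ha
  have hiSup : ∀ x, (∑' i, (A i).indicator (fun _ => (a i : ℝ≥0∞)) x) ^ p =
      ⨆ F, (familySum A a F x : ℝ≥0∞) ^ p := by
    intro x
    rw [tsum_indicator_eq_iSup_familySum]
    exact (ENNReal.orderIsoRpow p hp).map_iSup _
  simp_rw [hiSup]
  -- Monotone convergence along finite subfamilies. `M` enters only through monotonicity, so it need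
  -- not be measurable.
  rw [lintegral_iSup_directed]
  · refine iSup_le fun F => (lintegral_familySum_rpow_le hp hA hm hmE hEA hd hE hfin hγ hγΛ a F).trans ?_
    gcongr with x
    exact coe_familyMax_le hM F x
  · exact fun F => ((measurable_familySum hm).coe_nnreal_ennreal.pow_const p).aemeasurable
  · refine Monotone.directed_le fun F G h x => ?_
    dsimp only
    gcongr
    exact monotone_familySum a x h

/-- The weak type bound of a sparse sum by its maximal function. -/
theorem weakLpNorm_tsum_indicator_rpow_le [Countable ι] (hp : 0 < p)
    (hA : ∀ i j, A i ⊆ A j ∨ A j ⊆ A i ∨ Disjoint (A i) (A j))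
    (hm : ∀ i, MeasurableSet (A i)) (hmE : ∀ i, MeasurableSet (E i)) (hEA : ∀ i, E i ⊆ A i)
    (hd : Pairwise fun i j => Disjoint (E i) (E j)) (hE : ∀ i, μ (A i) ≤ Λ * μ (E i))
    (hfin : ∀ i, μ (A i) ≠ ∞) (hpos : ∀ i, μ (A i) ≠ 0) (hγ : 0 < γ)
    (hγΛ : (2 : ℝ≥0) ^ p * (γ * Λ) ≤ 2⁻¹) (a : ι → ℝ≥0∞) {M : X → ℝ≥0∞}
    (hM : ∀ i, ∀ x ∈ A i, a i ≤ M x) :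
    weakLpNorm (fun x => ∑' i, (A i).indicator (fun _ => a i) x) p μ ^ p ≤
      2 * ((2 / γ : ℝ≥0) ^ p * weakLpNorm M p μ ^ p) := by
  by_cases ha : ∃ i, a i = ∞
  · obtain ⟨i, hi⟩ := ha
    have hsub : ∀ t : ℝ≥0, A i ⊆ {x | (t : ℝ≥0∞) < M x} := fun t x hx =>
      lt_of_lt_of_le ENNReal.coe_lt_top (hi ▸ hM i x hx)
    have hw : weakLpNorm M p μ = ∞ := by
      refine top_le_iff.1 ?_
      calc ∞ = (⨆ t : ℝ≥0, (t : ℝ≥0∞)) * μ (A i) ^ (1 / p) := by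
            rw [ENNReal.iSup_coe_eq_top.2 (by simp), ENNReal.top_mul]
            simp [ENNReal.rpow_eq_zero_iff, hpos i, hfin i]
        _ ≤ weakLpNorm M p μ := by
            rw [ENNReal.iSup_mul]
            refine iSup_mono fun t => ?_
            gcongr
            exact hsub t
    rw [hw, ENNReal.top_rpow_of_pos hp, ENNReal.mul_top, ENNReal.mul_top two_ne_zero]
    · exact le_top
    · simp [ENNReal.rpow_eq_zero_iff, hγ.ne', hp.not_gt]
  push Not at ha
  lift a to ι → ℝ≥0 using ha
  rw [weakLpNorm_rpow hp]
  refine iSup_le fun t => ?_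
  have hU : {x | (t : ℝ≥0∞) < ∑' i, (A i).indicator (fun _ => (a i : ℝ≥0∞)) x} =
      ⋃ F, {x | (t : ℝ≥0∞) < familySum A a F x} := by
    ext x
    simp only [Set.mem_ofPred_eq, Set.mem_iUnion, tsum_indicator_eq_iSup_familySum, lt_iSup_iff]
  rw [hU, Directed.measure_iUnion, ENNReal.mul_iSup]
  · refine iSup_le fun F => ?_
    calc (t : ℝ≥0∞) ^ p * μ {x | (t : ℝ≥0∞) < familySum A a F x}
        ≤ weakLpNorm (fun x => (familySum A a F x : ℝ≥0∞)) p μ ^ p := by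
          rw [weakLpNorm_rpow hp]
          exact le_iSup (fun t : ℝ≥0 =>
            (t : ℝ≥0∞) ^ p * μ {x | (t : ℝ≥0∞) < familySum A a F x}) t
      _ ≤ _ := weakLpNorm_familySum_rpow_le hp hA hm hmE hEA hd hE hfin hγ hγΛ a F
      _ ≤ _ := by
          gcongr
          simpa using weakLpNorm_le_mul (μ := μ) hp one_pos (h := M)
            fun x => by simpa using coe_familyMax_le hM F x
  · refine Monotone.directed_le fun F G h x hx => ?_
    exact lt_of_lt_of_le hx (ENNReal.coe_le_coe.2 (monotone_familySum a x h))

end SparseFamilies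

/-! ### Measure and diameter of cubes. -/

namespace AxisCube

variable {n : ℕ} (Q : AxisCube n)

theorem toSet_eq_preimage_pi : Q.toSet = (WithLp.ofLp : EuclideanSpace ℝ (Fin n) → _) ⁻¹'
    Set.univ.pi fun i => Set.Ico (Q.corner i) (Q.corner i + Q.side) := by
  ext x
  simp [toSet]

theorem measurableSet_toSet : MeasurableSet Q.toSet := by
  rw [toSet_eq_preimage_pi]
  exact (PiLp.volume_preserving_ofLp (Fin n)).measurable
    (MeasurableSet.univ_pi fun _ => measurableSet_Ico)

theorem volume_toSet : volume Q.toSet = ENNReal.ofReal (Q.side ^ n) := by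
  rw [toSet_eq_preimage_pi, (PiLp.volume_preserving_ofLp (Fin n)).measure_preimage
    (MeasurableSet.univ_pi fun _ => measurableSet_Ico).nullMeasurableSet, volume_pi_pi]
  simp [ENNReal.ofReal_pow Q.side_pos.le]

theorem volume_toSet_ne_zero : volume Q.toSet ≠ 0 := by
  rw [volume_toSet]
  simpa using pow_pos Q.side_pos n

theorem volume_toSet_ne_top : volume Q.toSet ≠ ∞ := by
  rw [volume_toSet]
  exact ENNReal.ofReal_ne_top

variable {Q}

theorem norm_sub_le {x y : EuclideanSpace ℝ (Fin n)} (hx : x ∈ Q.toSet) (hy : y ∈ Q.toSet) :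
    ‖x - y‖ ≤ √n * Q.side := by
  have h : ∀ i, ‖(x - y) i‖ ^ 2 ≤ Q.side ^ 2 := fun i => by
    have h1 := hx i
    have h2 := hy i
    have : ‖(x - y) i‖ ≤ Q.side := by
      rw [PiLp.sub_apply, Real.norm_eq_abs, abs_le]
      constructor <;> linarith [h1.1, h1.2, h2.1, h2.2]
    gcongr
  rw [EuclideanSpace.norm_eq]
  calc √(∑ i, ‖(x - y) i‖ ^ 2) ≤ √(n * Q.side ^ 2) := by
        gcongr
        simpa using Finset.sum_le_sum fun i (_ : i ∈ Finset.univ) => h i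
    _ = √n * Q.side := by
        rw [Real.sqrt_mul (Nat.cast_nonneg n), Real.sqrt_sq Q.side_pos.le]

variable (Q)

theorem isBounded_toSet : Bornology.IsBounded Q.toSet :=
  Metric.isBounded_iff.2 ⟨√n * Q.side, fun _ hx _ hy => by
    rw [dist_eq_norm]
    exact norm_sub_le hx hy⟩

end AxisCube

/-! ### Muckenhoupt weights: sparseness passes from volume to `w dx`. -/

section Weights

variable {n : ℕ} {w : EuclideanSpace ℝ (Fin n) → ℝ} {q : ℝ}

theorem IsMuckenhouptWeight.aemeasurable_ofReal (hw : IsMuckenhouptWeight q w) :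
    AEMeasurable (fun x => ENNReal.ofReal (w x)) volume :=
  hw.locallyIntegrable.aestronglyMeasurable.aemeasurable.ennreal_ofReal

theorem weightMeasure_apply {B : Set (EuclideanSpace ℝ (Fin n))} (hB : MeasurableSet B) :
    weightMeasure w B = ∫⁻ x in B, ENNReal.ofReal (w x) :=
  withDensity_apply _ hB

theorem IsMuckenhouptWeight.weightMeasure_ne_zero (hw : IsMuckenhouptWeight q w)
    {B : Set (EuclideanSpace ℝ (Fin n))} (hB : MeasurableSet B) (h : volume B ≠ 0) :
    weightMeasure w B ≠ 0 := by
  rw [weightMeasure_apply hB]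
  intro h0
  rw [lintegral_eq_zero_iff' hw.aemeasurable_ofReal.restrict] at h0
  have hfalse : ∀ᵐ x ∂volume.restrict B, False := by
    filter_upwards [h0, ae_restrict_of_ae hw.pos] with x h1 h2
    exact absurd (ENNReal.ofReal_eq_zero.1 h1) (not_le.2 h2)
  rw [Filter.eventually_false_iff_eq_bot, ae_eq_bot, Measure.restrict_eq_zero] at hfalse
  exact h hfalse

theorem IsMuckenhouptWeight.weightMeasure_toSet_ne_top (hw : IsMuckenhouptWeight q w)
    (Q : AxisCube n) : weightMeasure w Q.toSet ≠ ∞ := by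
  rw [weightMeasure_apply Q.measurableSet_toSet]
  have hint : IntegrableOn w Q.toSet volume :=
    (hw.locallyIntegrable.integrableOn_isCompact Q.isBounded_toSet.isCompact_closure).mono_set
      subset_closure
  refine ne_top_of_le_ne_top hint.2.ne (lintegral_mono fun x => ?_)
  rw [← ofReal_norm]
  exact ENNReal.ofReal_le_ofReal (le_abs_self _)

/-- Hölder's inequality behind the `A_q` condition. -/
theorem IsMuckenhouptWeight.volume_rpow_le (hq : 1 < q) (hw : IsMuckenhouptWeight q w)
    {B : Set (EuclideanSpace ℝ (Fin n))} (hB : MeasurableSet B) :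
    volume B ^ q ≤ weightMeasure w B *
      (∫⁻ x in B, ENNReal.ofReal (w x) ^ (-1 / (q - 1))) ^ (q - 1) := by
  have hq0 : 0 < q := by linarith
  have hq1 : q - 1 ≠ 0 := by linarith
  have hconj : q.HolderConjugate (q / (q - 1)) := Real.HolderConjugate.conjExponent hq
  have hm := hw.aemeasurable_ofReal.restrict (s := B)
  -- Hölder for the splitting `1 = w^(1/q) w^(-1/q)`, valid almost everywhere since `w > 0`.
  have hH := ENNReal.lintegral_mul_le_Lp_mul_Lq (volume.restrict B) hconj
    (hm.pow_const (1 / q)) (hm.pow_const (-1 / q))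
  have h1 : ∫⁻ x in B, ((fun x => ENNReal.ofReal (w x) ^ (1 / q)) *
      fun x => ENNReal.ofReal (w x) ^ (-1 / q)) x = volume B := by
    rw [← setLIntegral_one]
    refine lintegral_congr_ae ?_
    filter_upwards [ae_restrict_of_ae hw.pos] with x hx
    rw [Pi.mul_apply, ← ENNReal.rpow_add _ _ (by simpa using hx) ENNReal.ofReal_ne_top]
    rw [show 1 / q + -1 / q = 0 by ring, ENNReal.rpow_zero]
  have h2 : ∀ x, (ENNReal.ofReal (w x) ^ (1 / q)) ^ q = ENNReal.ofReal (w x) := fun x => by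
    rw [← ENNReal.rpow_mul, one_div_mul_cancel hq0.ne', ENNReal.rpow_one]
  have h3 : ∀ x, (ENNReal.ofReal (w x) ^ (-1 / q)) ^ (q / (q - 1)) =
      ENNReal.ofReal (w x) ^ (-1 / (q - 1)) := fun x => by
    rw [← ENNReal.rpow_mul]
    congr 1
    field_simp
  rw [h1] at hH
  simp only [h2, h3] at hH
  calc volume B ^ q ≤ _ := ENNReal.rpow_le_rpow hH hq0.le
    _ = _ := by
      rw [ENNReal.mul_rpow_of_nonneg _ _ hq0.le, ← ENNReal.rpow_mul, ← ENNReal.rpow_mul,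
        one_div_mul_cancel hq0.ne', ENNReal.rpow_one, weightMeasure_apply hB]
      congr 2
      field_simp

/-- Half of a cube carries a fixed fraction of its `A_q` mass. -/
theorem IsMuckenhouptWeight.exists_weightMeasure_le (hq : 1 < q) (hw : IsMuckenhouptWeight q w) :
    ∃ Λ : ℝ≥0, ∀ (Q : AxisCube n) (B : Set (EuclideanSpace ℝ (Fin n))), MeasurableSet B →
      B ⊆ Q.toSet → volume Q.toSet ≤ 2 * volume B →
      weightMeasure w Q.toSet ≤ Λ * weightMeasure w B := by
  obtain ⟨K, hK⟩ := hw.bound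
  have hq0 : 0 < q := by linarith
  have hq1 : 0 < q - 1 := by linarith
  refine ⟨K * 2 ^ q, fun Q B hB hBQ hvol => ?_⟩
  set σ := ∫⁻ x in Q.toSet, ENNReal.ofReal (w x) ^ (-1 / (q - 1)) with hσ
  set V := volume Q.toSet with hV
  have hV0 : V ≠ 0 := Q.volume_toSet_ne_zero
  have hVt : V ≠ ∞ := Q.volume_toSet_ne_top
  have hAq : weightMeasure w Q.toSet * σ ^ (q - 1) ≤ K * V ^ q := by
    have h := hK Q
    rw [setLAverage_eq, setLAverage_eq, ← weightMeasure_apply Q.measurableSet_toSet,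
      ENNReal.div_rpow_of_nonneg _ _ hq1.le, ← hσ, ← hV] at h
    calc weightMeasure w Q.toSet * σ ^ (q - 1)
        = (weightMeasure w Q.toSet / V * (σ ^ (q - 1) / V ^ (q - 1))) * (V * V ^ (q - 1)) := by
          rw [mul_mul_mul_comm, ENNReal.div_mul_cancel hV0 hVt, ENNReal.div_mul_cancel]
          · simp [ENNReal.rpow_eq_zero_iff, hV0, hVt]
          · exact ENNReal.rpow_ne_top_of_nonneg hq1.le hVt
      _ ≤ K * (V * V ^ (q - 1)) := by gcongr
      _ = K * V ^ q := by
          congr 1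
          nth_rewrite 1 [← ENNReal.rpow_one V]
          rw [← ENNReal.rpow_add _ _ hV0 hVt, add_sub_cancel]
  have hVB : V ^ q ≤ 2 ^ q * volume B ^ q := by
    rw [← ENNReal.mul_rpow_of_nonneg _ _ hq0.le]
    gcongr
  -- Keeping the factor `V ^ q` on both sides avoids dividing by `σ`; only the finite nonzero `V ^
  -- q` is cancelled.
  have hkey : weightMeasure w Q.toSet * V ^ q ≤ (K * 2 ^ q * weightMeasure w B) * V ^ q := by
    calc weightMeasure w Q.toSet * V ^ q
        ≤ weightMeasure w Q.toSet * (2 ^ q * (weightMeasure w B * σ ^ (q - 1))) := by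
          gcongr
          refine hVB.trans ?_
          gcongr
          refine (hw.volume_rpow_le hq hB).trans ?_
          gcongr
          exact lintegral_mono_set hBQ
      _ = 2 ^ q * weightMeasure w B * (weightMeasure w Q.toSet * σ ^ (q - 1)) := by ring
      _ ≤ 2 ^ q * weightMeasure w B * (K * V ^ q) := by gcongr
      _ = _ := by ring
  have hVq0 : V ^ q ≠ 0 := by simp [ENNReal.rpow_eq_zero_iff, hV0, hVt]
  have hVqt : V ^ q ≠ ∞ := ENNReal.rpow_ne_top_of_nonneg hq0.le hVt
  rw [ENNReal.coe_mul, ENNReal.coe_rpow_of_nonneg _ hq0.le, ENNReal.coe_ofNat]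
  exact (ENNReal.mul_le_mul_iff_left hVq0 hVqt).1 hkey

end Weights

/-! ### Pointwise domination by the Riesz potential. -/

section RieszPotential

variable {n : ℕ}

theorem rieszConst_pos {β : ℝ} (hβ : 0 < β) (hβn : β < n) : 0 < rieszConst n β := by
  unfold rieszConst
  have h1 : 0 < Real.Gamma ((n - β) / 2) := Real.Gamma_pos_of_pos (by linarith)
  have h2 : 0 < Real.Gamma (β / 2) := Real.Gamma_pos_of_pos (by linarith)
  positivity

/-- On a cube, the fractional average is dominated by the Riesz potential. -/
theorem setLAverage_le_rieszPotential {β : ℝ} (hβ : 0 < β) (hβn : β < n)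
    (g : EuclideanSpace ℝ (Fin n) → ℝ≥0∞) {Q : AxisCube n} {x : EuclideanSpace ℝ (Fin n)}
    (hx : x ∈ Q.toSet) :
    ENNReal.ofReal (Q.side ^ β) * (⨍⁻ y in Q.toSet, g y ∂volume) ≤
      ENNReal.ofReal ((rieszConst n β)⁻¹ * √n ^ (n - β)) * rieszPotential β g x := by
  have hn : (0 : ℝ) < n := hβ.trans hβn
  have hℓ := Q.side_pos
  have hc := rieszConst_pos hβ hβn
  -- An upper bound for `|x - y|^(n-β)` on the cube, from its diameter; the kernel there is at least
  -- `D⁻¹`.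
  set D : ℝ := (√n * Q.side) ^ (n - β) with hD
  have hDpos : 0 < D := by positivity
  have hJ : (∫⁻ y in Q.toSet, g y) * (ENNReal.ofReal D)⁻¹ ≤
      ∫⁻ y, g y / ‖x - y‖ₑ ^ ((n : ℝ) - β) := by
    rw [← lintegral_mul_const' _ _ (by simpa using hDpos)]
    refine (setLIntegral_mono' Q.measurableSet_toSet fun y hy => ?_).trans
      (setLIntegral_le_lintegral Q.toSet _)
    rw [ENNReal.div_eq_inv_mul, mul_comm]
    gcongr
    rw [hD, ← ENNReal.ofReal_rpow_of_nonneg (by positivity) (by linarith), ← ofReal_norm]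
    exact ENNReal.rpow_le_rpow (ENNReal.ofReal_le_ofReal (AxisCube.norm_sub_le hx hy))
      (by linarith)
  have hconst : Q.side ^ β * (Q.side ^ n)⁻¹ =
      (rieszConst n β)⁻¹ * √n ^ (n - β) * (rieszConst n β * D⁻¹) := by
    rw [hD, Real.mul_rpow (by positivity) hℓ.le, Real.rpow_sub hℓ, Real.rpow_natCast]
    have : √(n : ℝ) ^ (n - β) ≠ 0 := by positivity
    field_simp
  rw [setLAverage_eq, Q.volume_toSet]
  calc ENNReal.ofReal (Q.side ^ β) * ((∫⁻ y in Q.toSet, g y) / ENNReal.ofReal (Q.side ^ n))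
      = ENNReal.ofReal (Q.side ^ β * (Q.side ^ n)⁻¹) * ∫⁻ y in Q.toSet, g y := by
        rw [ENNReal.ofReal_mul (by positivity), ENNReal.ofReal_inv_of_pos (by positivity),
          ENNReal.div_eq_inv_mul, mul_assoc]
    _ = ENNReal.ofReal ((rieszConst n β)⁻¹ * √n ^ (n - β)) * (ENNReal.ofReal (rieszConst n β) *
          ((∫⁻ y in Q.toSet, g y) * (ENNReal.ofReal D)⁻¹)) := by
        rw [hconst, ENNReal.ofReal_mul (by positivity), ENNReal.ofReal_mul hc.le,
          ENNReal.ofReal_inv_of_pos hDpos]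
        ring
    _ ≤ _ := by
        unfold rieszPotential
        gcongr

/-- The fractional maximal function is pointwise dominated by the Riesz potential. -/
theorem exists_fracMaximal_le_rieszPotential {𝕜 : Type*} [RCLike 𝕜] {α s : ℝ} (hα : 0 < α)
    (hs : 0 < s) (hsα : α * s < n) :
    ∃ C : ℝ≥0, 0 < C ∧ ∀ (f : EuclideanSpace ℝ (Fin n) → 𝕜) (x : EuclideanSpace ℝ (Fin n)),
      fracMaximal α s f x ≤
        C * rieszPotential (α * s) (fun y => ‖f y‖ₑ ^ s) x ^ (1 / s) := by
  have hβ : 0 < α * s := mul_pos hα hs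
  have hn : (0 : ℝ) < n := hβ.trans hsα
  have hc := rieszConst_pos hβ hsα
  refine ⟨((rieszConst n (α * s))⁻¹ * √n ^ (n - α * s)).toNNReal ^ (1 / s), ?_, fun f x => ?_⟩
  · refine NNReal.rpow_pos (Real.toNNReal_pos.2 ?_)
    positivity
  refine iSup₂_le fun Q hx => ?_
  have hs' : 0 ≤ 1 / s := by positivity
  rw [ENNReal.coe_rpow_of_nonneg _ hs', ← ENNReal.mul_rpow_of_nonneg _ _ hs']
  unfold fracAverage
  -- Moving `ℓ(Q)^α` inside the `1/s` power is what turns the order `α` into `αs`.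
  rw [show Q.side ^ α = (Q.side ^ (α * s)) ^ (1 / s) by
      rw [← Real.rpow_mul Q.side_pos.le, mul_assoc, mul_one_div_cancel hs.ne', mul_one],
    ← ENNReal.ofReal_rpow_of_nonneg (Real.rpow_nonneg Q.side_pos.le _) hs',
    ← ENNReal.mul_rpow_of_nonneg _ _ hs']
  exact ENNReal.rpow_le_rpow (setLAverage_le_rieszPotential hβ hsα _ hx) hs'

end RieszPotential

/-! ### Assembly for sparse families of cubes. -/

section Main

variable {n : ℕ}

/-- Sparse fractional sums are controlled by the fractional maximal function in `L^p(w)` and in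
`L^{p,∞}(w)`, for `w ∈ A_∞`. -/
theorem exists_sparseFracOp_le_fracMaximal {𝕜 : Type*} [RCLike 𝕜] {α s p : ℝ} (hp : 0 < p)
    {w : EuclideanSpace ℝ (Fin n) → ℝ} (hw : IsAInftyWeight w) :
    ∃ C : ℝ≥0, ∀ S : Set (AxisCube n), IsSparseFamily S →
      ∀ f : EuclideanSpace ℝ (Fin n) → 𝕜,
        eLpNorm (sparseFracOp α s S f) (ENNReal.ofReal p) (weightMeasure w) ≤
            C * eLpNorm (fracMaximal α s f) (ENNReal.ofReal p) (weightMeasure w) ∧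
        weakLpNorm (sparseFracOp α s S f) p (weightMeasure w) ≤
            C * weakLpNorm (fracMaximal α s f) p (weightMeasure w) := by
  obtain ⟨q, hq, hwq⟩ := hw
  obtain ⟨Λ, hΛ⟩ := hwq.exists_weightMeasure_le hq
  -- Chosen so that `2^p γ(Λ + 1) = 1/2`; the `+ 1` keeps `γ` positive even if `Λ = 0`.
  set γ : ℝ≥0 := (2 * (2 : ℝ≥0) ^ p * (Λ + 1))⁻¹ with hγ
  have hγpos : 0 < γ := by positivity
  have hγΛ : (2 : ℝ≥0) ^ p * (γ * Λ) ≤ 2⁻¹ := by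
    calc (2 : ℝ≥0) ^ p * (γ * Λ) ≤ (2 : ℝ≥0) ^ p * (γ * (Λ + 1)) := by
          gcongr
          exact le_self_add
      _ = 2⁻¹ := by
        rw [hγ]
        have : (2 : ℝ≥0) ^ p ≠ 0 := by positivity
        field_simp
  refine ⟨(2 * (2 / γ) ^ p) ^ (1 / p), fun S ⟨D, hD, hSD, E, hE, hdisj⟩ f => ?_⟩
  have hp' : 0 ≤ 1 / p := by positivity
  have hroot : ∀ {a b : ℝ≥0∞}, a ≤ 2 * ((2 / γ : ℝ≥0) ^ p * b) →
      a ^ (1 / p) ≤ ((2 * (2 / γ) ^ p) ^ (1 / p) : ℝ≥0) * b ^ (1 / p) := by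
    intro a b h
    rw [ENNReal.coe_rpow_of_nonneg _ hp', ← ENNReal.mul_rpow_of_nonneg _ _ hp', ENNReal.coe_mul,
      ENNReal.coe_rpow_of_nonneg _ hp.le, mul_assoc]
    exact ENNReal.rpow_le_rpow h hp'
  have hd : Pairwise fun i j : S => Disjoint (E i) (E j) := fun i j h =>
    hdisj i.2 j.2 fun h' => h (Subtype.ext h')
  -- Disjoint sets of positive volume are at most countably many, as volume is σ-finite.
  have hcount : Countable S := by
    have h := Measure.countable_meas_pos_of_disjoint_iUnion (μ := volume)
      (As := fun i : S => E i) (fun i => (hE i i.2).1) hd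
    have huniv : {i : S | 0 < volume (E i)} = Set.univ := Set.eq_univ_of_forall fun i => by
      refine (pos_iff_ne_zero (α := ℝ≥0∞)).2 fun h0 => (i : AxisCube n).volume_toSet_ne_zero ?_
      have h1 := (hE i i.2).2.2
      rwa [h0, mul_zero, nonpos_iff_eq_zero] at h1
    rw [huniv] at h
    exact Set.countable_univ_iff.1 h
  have hnest : ∀ i j : S, (i : AxisCube n).toSet ⊆ (j : AxisCube n).toSet ∨
      (j : AxisCube n).toSet ⊆ (i : AxisCube n).toSet ∨
      Disjoint (i : AxisCube n).toSet (j : AxisCube n).toSet := fun i j => by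
    rcases hD.nested i (hSD i.2) j (hSD j.2) with h | h | h
    · exact Or.inr (Or.inr (Set.disjoint_iff_inter_eq_empty.2 h))
    · exact Or.inr (Or.inl (Set.inter_eq_right.1 h))
    · exact Or.inl (Set.inter_eq_left.1 h)
  have hm : ∀ i : S, MeasurableSet (i : AxisCube n).toSet := fun i => i.1.measurableSet_toSet
  have hpos : ∀ i : S, weightMeasure w (i : AxisCube n).toSet ≠ 0 := fun i =>
    hwq.weightMeasure_ne_zero (hm i) i.1.volume_toSet_ne_zero
  have hfin : ∀ i : S, weightMeasure w (i : AxisCube n).toSet ≠ ∞ := fun i =>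
    hwq.weightMeasure_toSet_ne_top i.1
  have hΛE : ∀ i : S, weightMeasure w (i : AxisCube n).toSet ≤ Λ * weightMeasure w (E i) :=
    fun i => hΛ i (E i) (hE i i.2).1 (hE i i.2).2.1 (hE i i.2).2.2
  have hmax : ∀ i : S, ∀ x ∈ (i : AxisCube n).toSet, fracAverage α s f i ≤ fracMaximal α s f x :=
    fun i x hx => le_iSup₂_of_le i.1 hx le_rfl
  constructor
  · rw [eLpNorm_ofReal_eq hp, eLpNorm_ofReal_eq hp]
    exact hroot (lintegral_tsum_indicator_rpow_le hp hnest hm (fun i => (hE i i.2).1)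
      (fun i => (hE i i.2).2.1) hd hΛE hfin hpos hγpos hγΛ _ hmax)
  · have h := hroot (weakLpNorm_tsum_indicator_rpow_le hp hnest hm (fun i => (hE i i.2).1)
      (fun i => (hE i i.2).2.1) hd hΛE hfin hpos hγpos hγΛ _ hmax)
    simp only [← ENNReal.rpow_mul, mul_one_div_cancel hp.ne', ENNReal.rpow_one] at h
    exact h

end Main

theorem theorem5p1 {n : ℕ} {𝕜 : Type*} [RCLike 𝕜] {α s p : ℝ}
    (hα : 0 < α) (hαn : α < n) (hs : 1 ≤ s) (hsα : s < n / α) (hp : 0 < p)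
    {w : EuclideanSpace ℝ (Fin n) → ℝ} (hw : IsAInftyWeight w) :
    ∃ C : ℝ≥0, 0 < C ∧
      ∀ S : Set (AxisCube n), IsSparseFamily S →
      ∀ f : EuclideanSpace ℝ (Fin n) → 𝕜, AEMeasurable f volume →
        eLpNorm (sparseFracOp α s S f) (ENNReal.ofReal p) (weightMeasure w) ≤
            C * eLpNorm (fracMaximal α s f) (ENNReal.ofReal p) (weightMeasure w) ∧
        weakLpNorm (sparseFracOp α s S f) p (weightMeasure w) ≤
            C * weakLpNorm (fracMaximal α s f) p (weightMeasure w) ∧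
        eLpNorm (sparseFracOp α s S f) (ENNReal.ofReal p) (weightMeasure w) ≤
            C * eLpNorm (fun x => rieszPotential (α * s) (fun y => ‖f y‖ₑ ^ s) x ^ (1 / s))
              (ENNReal.ofReal p) (weightMeasure w) ∧
        weakLpNorm (sparseFracOp α s S f) p (weightMeasure w) ≤
            C * weakLpNorm (fun x => rieszPotential (α * s) (fun y => ‖f y‖ₑ ^ s) x ^ (1 / s))
              p (weightMeasure w) := by
  obtain ⟨C₁, h₁⟩ := exists_sparseFracOp_le_fracMaximal (𝕜 := 𝕜) (α := α) (s := s) hp hw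
  obtain ⟨C₂, hC₂, h₂⟩ := exists_fracMaximal_le_rieszPotential (𝕜 := 𝕜) (n := n) hα
    (by linarith : 0 < s) (by rwa [mul_comm, ← lt_div_iff₀ hα])
  have hle₁ : C₁ ≤ C₁ + C₁ * C₂ + 1 := by rw [add_assoc]; exact le_self_add
  have hle₂ : C₁ * C₂ ≤ C₁ + C₁ * C₂ + 1 := le_add_self.trans le_self_add
  -- One constant serves all four bounds; the `+ 1` ensures positivity.
  refine ⟨C₁ + C₁ * C₂ + 1, by positivity, fun S hS f _ => ?_⟩
  obtain ⟨hstrong, hweak⟩ := h₁ S hS f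
  refine ⟨hstrong.trans (by gcongr), hweak.trans (by gcongr), ?_, ?_⟩
  · calc _ ≤ _ := hstrong
      _ ≤ C₁ * (C₂ • eLpNorm (fun x => rieszPotential (α * s) (fun y => ‖f y‖ₑ ^ s) x ^ (1 / s))
              (ENNReal.ofReal p) (weightMeasure w)) := by
          gcongr
          exact eLpNorm_le_nnreal_smul_eLpNorm_of_ae_le_mul'
            (Filter.Eventually.of_forall fun x => by simpa using h₂ f x) _
      _ ≤ _ := by
          rw [ENNReal.smul_def, smul_eq_mul, ← mul_assoc, ← ENNReal.coe_mul]
          gcongr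
  · calc _ ≤ _ := hweak
      _ ≤ C₁ * (C₂ * weakLpNorm (fun x =>
            rieszPotential (α * s) (fun y => ‖f y‖ₑ ^ s) x ^ (1 / s)) p (weightMeasure w)) := by
          gcongr
          exact weakLpNorm_le_mul hp hC₂ (h₂ f)
      _ ≤ _ := by
          rw [← mul_assoc, ← ENNReal.coe_mul]
          gcongr
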